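/- Let $T\subset\mathbb R^3$ be the closed triangle with affinely independent vertices $p_1,p_2,p_3$ (indices cyclic modulo $3$), and put $s_i=p_{i-1}-p_{i+1}$ (so $s_1=p_3-p_2$, $s_2=p_1-p_3$, $s_3=p_2-p_1$), $\ell_i=|s_i|$, $\hat s_i=s_i/\ell_i$, $$\hat w=\frac{\hat s_1\times\hat s_2}{|\hat s_1\times\hat s_2|},\qquad \hat u=\hat s_3,\qquad \hat v=\hat w\times\hat u,\qquad \hat m_i=\hat s_i\times\hat w\quad(i=1,2,3),$$ and $u_3=-s_2\cdot\hat u$, $v_3=-s_2\cdot\hat v$. Let the unit normal of $T$ be $\hat n=\hat w$. Let $r_0\in\mathbb R^3\setminus T$ (the position of the dipole) and $q\in\mathbb R^3$ (its moment), and let $u_0,v_0,w_0$ be defined by $r_0=p_1+u_0\hat u+v_0\hat v-w_0\hat w$. Put $$t_1^0=\frac{v_0(u_3-\ell_3)+v_3(\ell_3-u_0)}{\ell_1},\qquad t_2^0=\frac{u_0v_3-v_0u_3}{\ell_2},\qquad t_3^0=v_0,$$ $$s_1^-=-\frac{(\ell_3-u_0)(\ell_3-u_3)+v_0v_3}{\ell_1},\qquad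 s_1^+=\frac{(u_3-u_0)(u_3-\ell_3)+v_3(v_3-v_0)}{\ell_1},$$ $$s_2^-=-\frac{u_3(u_3-u_0)+v_3(v_3-v_0)}{\ell_2},\qquad s_2^+=\frac{u_0u_3+v_0v_3}{\ell_2},\qquad s_3^-=-u_0,\qquad s_3^+=\ell_3-u_0,$$ $$R_i^0=\sqrt{(t_i^0)^2+w_0^2},\qquad R_i^\pm=\sqrt{(s_i^\pm)^2+(t_i^0)^2+w_0^2},\qquad R_i^s=\frac1{(R_i^0)^2}\left(\frac{s_i^+}{R_i^+}-\frac{s_i^-}{R_i^-}\right).$$ If $R_i^0=0$, i.e. if $r_0$ lies on the line through the side opposite to $p_i$, we set $R_i^s=0$; its value is then irrelevant, because $w_0=t_i^0=0$. With $R=r-r_0$, the function $r\mapsto \hat n\cdot\nabla_r\!\left(\dfrac{q\cdot R}{|R|^3}\right)$ is integrable on $T$ with respect to surface area, and $$I_0:=\int_T \hat n\cdot\nabla_r\!\left(\frac{q\cdot R}{|R|^3}\right)dS(r)\;=\;q\cdot\sum_{i=1}^3 R_i^s\left(w_0\,\hat m_i-t_i^0\,\hat w\right).$$ -/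

import Mathlib

open MeasureTheory
open scoped InnerProductSpace

/-- Euclidean three-space (global Cartesian frame). -/
abbrev E3 : Type := EuclideanSpace ℝ (Fin 3)

/-- The cross product on Euclidean three-space. -/
noncomputable def cross3 (a b : E3) : E3 :=
  WithLp.toLp 2 (crossProduct a.ofLp b.ofLp)

/-- The dipole potential kernel `f(r) = q · R / R³`, where `R = r - r₀` and `R = |R|`. -/
noncomputable def dipoleKernel (q r₀ r : E3) : ℝ :=
  ⟪q, r - r₀⟫_ℝ / ‖r - r₀‖ ^ 3

namespace Tri

/- The nodes `p₁, p₂, p₃` of the triangle are `p 0, p 1, p 2`, the indices being cyclic (`Fin 3`);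
side `i` is the side opposite to node `i`. -/

/-- The (closed, filled) triangle with nodes `p`. -/
def tri (p : Fin 3 → E3) : Set E3 := convexHull ℝ (Set.range p)

/-- Side vectors `sᵢ = pᵢ₋₁ - pᵢ₊₁`. -/
noncomputable def side (p : Fin 3 → E3) (i : Fin 3) : E3 := p (i - 1) - p (i + 1)

/-- Side lengths `sᵢ = |sᵢ|`. -/
noncomputable def len (p : Fin 3 → E3) (i : Fin 3) : ℝ := ‖side p i‖

/-- Unit side vectors `ŝᵢ = sᵢ / |sᵢ|`. -/
noncomputable def sHat (p : Fin 3 → E3) (i : Fin 3) : E3 := (len p i)⁻¹ • side p i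

/-- The unit vector `ŵ` normal to the triangle: the normalisation of `ŝ₁ × ŝ₂`. -/
noncomputable def wHat (p : Fin 3 → E3) : E3 :=
  ‖cross3 (sHat p 0) (sHat p 1)‖⁻¹ • cross3 (sHat p 0) (sHat p 1)

/-- `û = ŝ₃`. -/
noncomputable def uHat (p : Fin 3 → E3) : E3 := sHat p 2

/-- `v̂ = ŵ × û`. -/
noncomputable def vHat (p : Fin 3 → E3) : E3 := cross3 (wHat p) (uHat p)

/-- `m̂ᵢ = ŝᵢ × ŵ`, the in-plane normal to side `i`. -/
noncomputable def mHat (p : Fin 3 → E3) (i : Fin 3) : E3 := cross3 (sHat p i) (wHat p)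

/-- `u₃`, the first local coordinate of the node `p₃`. -/
noncomputable def u3 (p : Fin 3 → E3) : ℝ := -⟪side p 1, uHat p⟫_ℝ

/-- `v₃`, the second local coordinate of the node `p₃`. -/
noncomputable def v3 (p : Fin 3 → E3) : ℝ := -⟪side p 1, vHat p⟫_ℝ

/- The source is `r₀ = p₁ + u₀ û + v₀ v̂ - w₀ ŵ`; note the sign of `w₀`. -/

/-- `u₀`. -/
noncomputable def u0 (p : Fin 3 → E3) (r₀ : E3) : ℝ := ⟪r₀ - p 0, uHat p⟫_ℝ

/-- `v₀`. -/
noncomputable def v0 (p : Fin 3 → E3) (r₀ : E3) : ℝ := ⟪r₀ - p 0, vHat p⟫_ℝ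

/-- `w₀`. -/
noncomputable def w0 (p : Fin 3 → E3) (r₀ : E3) : ℝ := -⟪r₀ - p 0, wHat p⟫_ℝ

/-- `tᵢ⁰`, the signed in-plane distance from the projection `ρ` of `r₀` to the line through
side `i`. -/
noncomputable def t0 (p : Fin 3 → E3) (r₀ : E3) : Fin 3 → ℝ :=
  ![(v0 p r₀ * (u3 p - len p 2) + v3 p * (len p 2 - u0 p r₀)) / len p 0,
    (u0 p r₀ * v3 p - v0 p r₀ * u3 p) / len p 1,
    v0 p r₀]

/-- `sᵢ⁻`, the abscissa along `ŝᵢ`, measured from the foot of `ρ`, of the starting point `pᵢ₊₁`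
of side `i`. -/
noncomputable def sMinus (p : Fin 3 → E3) (r₀ : E3) : Fin 3 → ℝ :=
  ![-((len p 2 - u0 p r₀) * (len p 2 - u3 p) + v0 p r₀ * v3 p) / len p 0,
    -(u3 p * (u3 p - u0 p r₀) + v3 p * (v3 p - v0 p r₀)) / len p 1,
    -u0 p r₀]

/-- `sᵢ⁺`, the abscissa along `ŝᵢ`, measured from the foot of `ρ`, of the end point `pᵢ₋₁`
of side `i`. -/
noncomputable def sPlus (p : Fin 3 → E3) (r₀ : E3) : Fin 3 → ℝ :=
  ![((u3 p - u0 p r₀) * (u3 p - len p 2) + v3 p * (v3 p - v0 p r₀)) / len p 0,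
    (u0 p r₀ * u3 p + v0 p r₀ * v3 p) / len p 1,
    len p 2 - u0 p r₀]

/-- `Rᵢ⁰`, the distance from `r₀` to the line through side `i`. -/
noncomputable def R0 (p : Fin 3 → E3) (r₀ : E3) (i : Fin 3) : ℝ :=
  √(t0 p r₀ i ^ 2 + w0 p r₀ ^ 2)

/-- `Rᵢ⁻`. -/
noncomputable def RMinus (p : Fin 3 → E3) (r₀ : E3) (i : Fin 3) : ℝ :=
  √(sMinus p r₀ i ^ 2 + t0 p r₀ i ^ 2 + w0 p r₀ ^ 2)

/-- `Rᵢ⁺`. -/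
noncomputable def RPlus (p : Fin 3 → E3) (r₀ : E3) (i : Fin 3) : ℝ :=
  √(sPlus p r₀ i ^ 2 + t0 p r₀ i ^ 2 + w0 p r₀ ^ 2)

/-- `Rᵢˢ`. If `Rᵢ⁰ = 0` (the source lies on the line through side `i`), this is `0` by the
convention for division; its value is then immaterial, as `w₀ = tᵢ⁰ = 0`. -/
noncomputable def Rs (p : Fin 3 → E3) (r₀ : E3) (i : Fin 3) : ℝ :=
  1 / R0 p r₀ i ^ 2 * (sPlus p r₀ i / RPlus p r₀ i - sMinus p r₀ i / RMinus p r₀ i)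

end Tri

/-! Put the source at the origin of the frame `û, v̂, ŵ`. On the plane of the triangle `R` has
constant normal component `c = w₀`, so the integrand is `q_w/R³ - 3c(q·R)/R⁵`. Because `R² = ρ² +
c²`, with `ρ` the in-plane part of `R`, this is the planar divergence of `F = (c q - q_w R)/R³`
(in-plane part). `F` is smooth near the triangle, as the source is off it.

The divergence theorem leaves the flux of `F` through the three sides. Along side `i` the product
`ρ·m̂ᵢ = tᵢ⁰` is constant, so the flux is `c q·m̂ᵢ - q_w tᵢ⁰` times the integral of `R⁻³` along the
side, and `s/√(s² + k)` is an antiderivative of `k/√(s² + k)³` with `k = (Rᵢ⁰)²`.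

`integral_stdTriangle_dipole` is the divergence theorem, pulled back to the standard triangle;
`integral_side` evaluates the fluxes; `setIntegral_planeMap_image` converts surface area into
Lebesgue measure; `inner_gradient_dipoleKernel` computes the integrand. -/

/-! ### Fubini and the fundamental theorem of calculus on the standard triangle -/

/-- The standard closed triangle in the coordinate plane. -/
def stdTriangle : Set (ℝ × ℝ) := {z | 0 ≤ z.1 ∧ 0 ≤ z.2 ∧ z.1 + z.2 ≤ 1}

theorem isCompact_stdTriangle : IsCompact stdTriangle := by
  have hc : IsClosed stdTriangle := by
    refine (isClosed_le continuous_const continuous_fst).inter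
      ((isClosed_le continuous_const continuous_snd).inter
        (isClosed_le (continuous_fst.add continuous_snd) continuous_const))
  refine (isCompact_Icc.prod isCompact_Icc).of_isClosed_subset (s := Set.Icc (0:ℝ) 1 ×ˢ Set.Icc (0:ℝ) 1) hc ?_
  rintro ⟨x, y⟩ ⟨h1, h2, h3⟩
  simp only at h1 h2 h3
  exact ⟨⟨h1, by linarith⟩, ⟨h2, by linarith⟩⟩

/-- Half of the divergence theorem: Fubini, then the fundamental theorem on each slice `[0, 1 - y]`.
Regularity is asked only on the closed triangle, since the source may lie elsewhere in its plane. -/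
theorem integral_stdTriangle_of_hasDerivAt_fst {G D : ℝ × ℝ → ℝ}
    (hD : ContinuousOn D stdTriangle)
    (hG : ∀ z ∈ stdTriangle, HasDerivAt (fun x => G (x, z.2)) (D z) z.1) :
    ∫ z in stdTriangle, D z = ∫ y in (0 : ℝ)..1, (G (1 - y, y) - G (0, y)) := by
  have hS : MeasurableSet stdTriangle := isCompact_stdTriangle.measurableSet
  have hint : Integrable (stdTriangle.indicator D) (volume : Measure (ℝ × ℝ)) :=
    (integrable_indicator_iff hS).2 (hD.integrableOn_compact isCompact_stdTriangle)
  rw [← integral_indicator hS, Measure.volume_eq_prod, integral_prod_symm _ hint,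
    intervalIntegral.integral_of_le zero_le_one, ← integral_Icc_eq_integral_Ioc,
    ← integral_indicator measurableSet_Icc]
  congr 1
  ext y
  by_cases hy : y ∈ Set.Icc (0 : ℝ) 1
  · rw [Set.indicator_of_mem hy]
    have hy1 : (0 : ℝ) ≤ 1 - y := by linarith [hy.2]
    have hmem : ∀ x ∈ Set.Icc (0 : ℝ) (1 - y), (x, y) ∈ stdTriangle := fun x hx =>
      ⟨hx.1, hy.1, by have := hx.2; simp only; linarith⟩
    have hind : (fun x => stdTriangle.indicator D (x, y)) =
        (Set.Icc (0 : ℝ) (1 - y)).indicator (fun x => D (x, y)) := by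
      ext x
      by_cases hx : x ∈ Set.Icc (0 : ℝ) (1 - y)
      · rw [Set.indicator_of_mem hx, Set.indicator_of_mem (hmem x hx)]
      · rw [Set.indicator_of_notMem hx, Set.indicator_of_notMem]
        rintro ⟨h1, h2, h3⟩
        simp only at h1 h2 h3
        exact hx ⟨h1, by linarith⟩
    rw [hind, integral_indicator measurableSet_Icc, integral_Icc_eq_integral_Ioc,
      ← intervalIntegral.integral_of_le hy1]
    refine intervalIntegral.integral_eq_sub_of_hasDerivAt (f := fun x => G (x, y)) ?_ ?_
    · intro x hx
      rw [Set.uIcc_of_le hy1] at hx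
      exact hG _ (hmem x hx)
    · refine ContinuousOn.intervalIntegrable ?_
      rw [Set.uIcc_of_le hy1]
      exact hD.comp (by fun_prop) hmem
  · rw [Set.indicator_of_notMem hy]
    have hind : (fun x => stdTriangle.indicator D (x, y)) = fun _ => 0 := by
      ext x
      refine Set.indicator_of_notMem ?_ _
      rintro ⟨h1, h2, h3⟩
      simp only at h1 h2 h3
      exact hy ⟨h2, by linarith⟩
    simp [hind]

theorem integral_stdTriangle_of_hasDerivAt_snd {G D : ℝ × ℝ → ℝ}
    (hD : ContinuousOn D stdTriangle)
    (hG : ∀ z ∈ stdTriangle, HasDerivAt (fun y => G (z.1, y)) (D z) z.2) :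
    ∫ z in stdTriangle, D z = ∫ x in (0 : ℝ)..1, (G (x, 1 - x) - G (x, 0)) := by
  have hswap : ∀ z, z.swap ∈ stdTriangle ↔ z ∈ stdTriangle := by
    rintro ⟨x, y⟩
    simp only [stdTriangle, Prod.swap, Set.mem_ofPred_eq, add_comm y x]
    tauto
  have h := integral_stdTriangle_of_hasDerivAt_fst (G := G ∘ Prod.swap) (D := D ∘ Prod.swap)
    (hD.comp continuous_swap.continuousOn fun z hz => (hswap z).2 hz)
    (fun z hz => hG z.swap ((hswap z).2 hz))
  have hmp : MeasurePreserving (Prod.swap : ℝ × ℝ → ℝ × ℝ) volume volume :=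
    Measure.measurePreserving_swap
  have := hmp.setIntegral_preimage_emb MeasurableEquiv.prodComm.measurableEmbedding D stdTriangle
  have hpre : Prod.swap ⁻¹' stdTriangle = stdTriangle := Set.ext hswap
  rw [hpre] at this
  rw [← this]
  exact h

/-! ### Flux across one side -/

theorem hasDerivAt_div_sqrt_sq_add {k : ℝ} (hk : 0 < k) (x : ℝ) :
    HasDerivAt (fun x => x / √(x ^ 2 + k)) (k / √(x ^ 2 + k) ^ 3) x := by
  have hN : 0 < x ^ 2 + k := by positivity
  have hs := Real.sqrt_pos.2 hN
  have h1 : HasDerivAt (fun x : ℝ => x ^ 2 + k) (2 * x) x := by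
    simpa using (hasDerivAt_pow 2 x).add_const k
  refine ((hasDerivAt_id x).div (h1.sqrt hN.ne') hs.ne').congr_deriv ?_
  have h2 : √(x ^ 2 + k) ^ 2 = x ^ 2 + k := Real.sq_sqrt hN.le
  simp only [id]
  field_simp
  linear_combination h2

/-- The flux of `(c q - q_w R) / R³` across a segment parametrised over `[0, 1]`. -/
theorem integral_side {a b da db c qu qv qw l t sm sp : ℝ} (hl : 0 < l)
    (hl2 : l ^ 2 = da ^ 2 + db ^ 2) (ht : l * t = a * db - b * da)
    (hsm : l * sm = a * da + b * db) (hsp : l * sp = (a + da) * da + (b + db) * db) :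
    ∫ s in (0 : ℝ)..1, (c * (qu * db - qv * da) - qw * (a * db - b * da)) /
        √((a + s * da) ^ 2 + (b + s * db) ^ 2 + c ^ 2) ^ 3 =
      (c * (qu * db - qv * da) / l - qw * t) * (1 / √(t ^ 2 + c ^ 2) ^ 2 *
        (sp / √(sp ^ 2 + t ^ 2 + c ^ 2) - sm / √(sm ^ 2 + t ^ 2 + c ^ 2))) := by
  have hsp' : sp = sm + l := by
    apply mul_left_cancel₀ hl.ne'
    rw [hsp, mul_add, hsm, ← sq, hl2]; ring
  -- `(sm, t)` are the coordinates of `(a, b)` in an orthogonal frame aligned with the side, so only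
  -- the abscissa varies along it.
  have hN : ∀ s : ℝ, (a + s * da) ^ 2 + (b + s * db) ^ 2 + c ^ 2 =
      (sm + l * s) ^ 2 + (t ^ 2 + c ^ 2) := by
    intro s
    have h1 : l ^ 2 * (sm ^ 2 + t ^ 2) = l ^ 2 * (a ^ 2 + b ^ 2) := by
      have : l ^ 2 * (sm ^ 2 + t ^ 2) = (l * sm) ^ 2 + (l * t) ^ 2 := by ring
      rw [this, hsm, ht, hl2]; ring
    have h2 := mul_left_cancel₀ (pow_ne_zero 2 hl.ne') h1
    linear_combination (-h2) - 2 * s * hsm - s ^ 2 * hl2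
  -- If the source is on the line of the side, then `c = t = 0` and the constant numerator vanishes,
  -- so both sides are `0` whatever the divisions by zero give.
  rcases (show 0 ≤ t ^ 2 + c ^ 2 by positivity).eq_or_lt with hk | hk
  · have ht0 : t = 0 := by nlinarith [sq_nonneg t, sq_nonneg c]
    have hc0 : c = 0 := by nlinarith [sq_nonneg t, sq_nonneg c]
    rw [← ht, ht0, hc0]
    simp
  · have hd : ∀ s : ℝ, HasDerivAt (fun s => (sm + l * s) / √((sm + l * s) ^ 2 + (t ^ 2 + c ^ 2)))
        (l * (t ^ 2 + c ^ 2) / √((sm + l * s) ^ 2 + (t ^ 2 + c ^ 2)) ^ 3) s := by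
      intro s
      have h1 : HasDerivAt (fun s : ℝ => sm + l * s) l s := by
        simpa using ((hasDerivAt_id s).const_mul l).const_add sm
      refine ((hasDerivAt_div_sqrt_sq_add hk (sm + l * s)).comp s h1).congr_deriv ?_
      ring
    have hpos : ∀ s : ℝ, 0 < √((sm + l * s) ^ 2 + (t ^ 2 + c ^ 2)) := fun s =>
      Real.sqrt_pos.2 (by positivity)
    have hftc := intervalIntegral.integral_eq_sub_of_hasDerivAt (a := 0) (b := 1)
      (fun s _ => hd s) (Continuous.intervalIntegrable (by
        refine Continuous.div (by fun_prop) (by fun_prop) fun s => (pow_pos (hpos s) 3).ne') _ _)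
    simp_rw [hN]
    simp_rw [div_eq_mul_inv] at hftc ⊢
    rw [intervalIntegral.integral_const_mul] at hftc ⊢
    rw [← ht, Real.sq_sqrt hk.le, hsp', add_assoc (sm ^ 2), add_assoc ((sm + l) ^ 2)]
    simp only [mul_one, mul_zero, add_zero] at hftc
    rw [← hftc]
    field_simp

/-! ### Divergence theorem in reference coordinates -/

theorem HasDerivAt.div_sqrt_pow_three {f n : ℝ → ℝ} {f' n' x : ℝ} (hf : HasDerivAt f f' x)
    (hn : HasDerivAt n n' x) (hx : 0 < n x) :
    HasDerivAt (fun y => f y / √(n y) ^ 3) (f' / √(n x) ^ 3 - 3 * f x * (n' / 2) / √(n x) ^ 5) x := by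
  have hs := Real.sqrt_pos.2 hx
  refine (hf.div ((hn.sqrt hx.ne').pow 3) (pow_pos hs 3).ne').congr_deriv ?_
  simp only [Pi.pow_apply]
  field_simp
  norm_num
  ring

/-- Divergence theorem for the field `(c q - q_w R) / R³` on the triangle with vertices `(0, 0)`,
`(L, 0)`, `(U, V)`, the source being at height `c` over `(a₀, b₀)`. -/
theorem integral_stdTriangle_dipole {L U V a₀ b₀ c qu qv qw : ℝ}
    (hN : ∀ z ∈ stdTriangle, 0 < (L * z.1 + U * z.2 - a₀) ^ 2 + (V * z.2 - b₀) ^ 2 + c ^ 2) :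
    ∫ z in stdTriangle, L * V *
        (qw / √((L * z.1 + U * z.2 - a₀) ^ 2 + (V * z.2 - b₀) ^ 2 + c ^ 2) ^ 3 -
        3 * c * (qu * (L * z.1 + U * z.2 - a₀) + qv * (V * z.2 - b₀) + qw * c) /
          √((L * z.1 + U * z.2 - a₀) ^ 2 + (V * z.2 - b₀) ^ 2 + c ^ 2) ^ 5) =
      (∫ s in (0 : ℝ)..1, (c * (qu * V - qv * (U - L)) - qw * ((L - a₀) * V - (-b₀) * (U - L))) /
        √(((L - a₀) + s * (U - L)) ^ 2 + ((-b₀) + s * V) ^ 2 + c ^ 2) ^ 3) +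
      (∫ s in (0 : ℝ)..1,
        (c * (qu * (-V) - qv * (-U)) - qw * ((U - a₀) * (-V) - (V - b₀) * (-U))) /
        √(((U - a₀) + s * (-U)) ^ 2 + ((V - b₀) + s * (-V)) ^ 2 + c ^ 2) ^ 3) +
      ∫ s in (0 : ℝ)..1, (c * (qu * 0 - qv * L) - qw * ((-a₀) * 0 - (-b₀) * L)) /
        √(((-a₀) + s * L) ^ 2 + ((-b₀) + s * 0) ^ 2 + c ^ 2) ^ 3 := by
  set N : ℝ × ℝ → ℝ := fun z => (L * z.1 + U * z.2 - a₀) ^ 2 + (V * z.2 - b₀) ^ 2 + c ^ 2 with hNdef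
  have hNc : Continuous N := by fun_prop
  -- `(P, Q)/R³` is the Piola transform of `F` under `(x, y) ↦ (Lx + Uy, Vy)`: the adjugate matrix
  -- `[[V, -U], [0, L]]` applied to `F`. Hence its divergence is `LV` times that of `F`.
  set P : ℝ × ℝ → ℝ := fun z =>
    V * (c * qu - qw * (L * z.1 + U * z.2 - a₀)) - U * (c * qv - qw * (V * z.2 - b₀)) with hP
  set Q : ℝ × ℝ → ℝ := fun z => L * (c * qv - qw * (V * z.2 - b₀)) with hQ
  have hPc : Continuous P := by fun_prop
  have hQc : Continuous Q := by fun_prop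
  have hs : ∀ z ∈ stdTriangle, 0 < √(N z) := fun z hz => Real.sqrt_pos.2 (hN z hz)
  have hx := integral_stdTriangle_of_hasDerivAt_fst (G := fun z => P z / √(N z) ^ 3)
    (D := fun z => V * (-(qw * L)) / √(N z) ^ 3 -
      3 * P z * (2 * (L * z.1 + U * z.2 - a₀) * L / 2) / √(N z) ^ 5)
    (by
      refine ContinuousOn.sub (ContinuousOn.div (by fun_prop) (by fun_prop) ?_)
        (ContinuousOn.div (by fun_prop) (by fun_prop) ?_)
      · exact fun z hz => (pow_pos (hs z hz) 3).ne'
      · exact fun z hz => (pow_pos (hs z hz) 5).ne')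
    (by
      intro z hz
      have h0 : HasDerivAt (fun x : ℝ => L * x + U * z.2 - a₀) L z.1 := by
        simpa using (((hasDerivAt_id z.1).const_mul L).add_const (U * z.2)).sub_const a₀
      have h1 : HasDerivAt (fun x => P (x, z.2)) (V * (-(qw * L))) z.1 := by
        simpa [hP] using (((h0.const_mul qw).const_sub (c * qu)).const_mul V).sub_const
          (U * (c * qv - qw * (V * z.2 - b₀)))
      have h2 : HasDerivAt (fun x => N (x, z.2)) (2 * (L * z.1 + U * z.2 - a₀) * L) z.1 := by
        simpa [hNdef] using ((h0.pow 2).add_const ((V * z.2 - b₀) ^ 2)).add_const (c ^ 2)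
      exact h1.div_sqrt_pow_three h2 (hN z hz))
  have hy := integral_stdTriangle_of_hasDerivAt_snd (G := fun z => Q z / √(N z) ^ 3)
    (D := fun z => L * (-(qw * V)) / √(N z) ^ 3 -
      3 * Q z * ((2 * (L * z.1 + U * z.2 - a₀) * U + 2 * (V * z.2 - b₀) * V) / 2) / √(N z) ^ 5)
    (by
      refine ContinuousOn.sub (ContinuousOn.div (by fun_prop) (by fun_prop) ?_)
        (ContinuousOn.div (by fun_prop) (by fun_prop) ?_)
      · exact fun z hz => (pow_pos (hs z hz) 3).ne'
      · exact fun z hz => (pow_pos (hs z hz) 5).ne')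
    (by
      intro z hz
      have h0 : HasDerivAt (fun y : ℝ => L * z.1 + U * y - a₀) U z.2 := by
        simpa using (((hasDerivAt_id z.2).const_mul U).const_add (L * z.1)).sub_const a₀
      have h0' : HasDerivAt (fun y : ℝ => V * y - b₀) V z.2 := by
        simpa using ((hasDerivAt_id z.2).const_mul V).sub_const b₀
      have h1 : HasDerivAt (fun y => Q (z.1, y)) (L * (-(qw * V))) z.2 := by
        simpa [hQ] using ((h0'.const_mul qw).const_sub (c * qv)).const_mul L
      have h2 : HasDerivAt (fun y => N (z.1, y))
          (2 * (L * z.1 + U * z.2 - a₀) * U + 2 * (V * z.2 - b₀) * V) z.2 := by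
        simpa [hNdef] using ((h0.pow 2).add (h0'.pow 2)).add_const (c ^ 2)
      exact h1.div_sqrt_pow_three h2 (hN z hz))
  have hint : ∀ {D : ℝ × ℝ → ℝ}, ContinuousOn D stdTriangle → IntegrableOn D stdTriangle :=
    fun hD => hD.integrableOn_compact isCompact_stdTriangle
  have hii : ∀ {n : ℕ} {f : ℝ → ℝ} {g : ℝ → ℝ × ℝ}, Continuous f → Continuous g →
      (∀ s ∈ Set.Icc (0 : ℝ) 1, g s ∈ stdTriangle) →
      IntervalIntegrable (fun s => f s / √(N (g s)) ^ n) volume 0 1 := by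
    intro n f g hf hg hgm
    refine ContinuousOn.intervalIntegrable ?_
    rw [Set.uIcc_of_le zero_le_one]
    exact ContinuousOn.div (by fun_prop) (by fun_prop)
      fun s hs' => (pow_pos (hs _ (hgm s hs')) n).ne'
  have hhyp : ∀ s ∈ Set.Icc (0 : ℝ) 1, ((1 - s, s) : ℝ × ℝ) ∈ stdTriangle := fun s h =>
    ⟨by simpa using h.2, h.1, by simp⟩
  have hhyp' : ∀ s ∈ Set.Icc (0 : ℝ) 1, ((s, 1 - s) : ℝ × ℝ) ∈ stdTriangle := fun s h =>
    ⟨h.1, by simpa using h.2, by simp⟩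
  have hleft : ∀ s ∈ Set.Icc (0 : ℝ) 1, ((0, s) : ℝ × ℝ) ∈ stdTriangle := fun s h =>
    ⟨le_rfl, h.1, by simpa using h.2⟩
  have hbot : ∀ s ∈ Set.Icc (0 : ℝ) 1, ((s, 0) : ℝ × ℝ) ∈ stdTriangle := fun s h =>
    ⟨h.1, le_rfl, by simpa using h.2⟩
  rw [intervalIntegral.integral_sub (hii (by fun_prop) (by fun_prop) hhyp)
    (hii (by fun_prop) (by fun_prop) hleft)] at hx
  rw [intervalIntegral.integral_sub (hii (by fun_prop) (by fun_prop) hhyp')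
    (hii (by fun_prop) (by fun_prop) hbot)] at hy
  -- The boundary is traversed counterclockwise, which reverses some of the slice parameters.
  have hrev : ∀ f : ℝ → ℝ, ∫ s in (0 : ℝ)..1, f (1 - s) = ∫ s in (0 : ℝ)..1, f s := by
    intro f
    simp
  have hsum : ∫ z in stdTriangle, L * V *
        (qw / √(N z) ^ 3 -
        3 * c * (qu * (L * z.1 + U * z.2 - a₀) + qv * (V * z.2 - b₀) + qw * c) / √(N z) ^ 5) =
      (∫ z in stdTriangle, (V * (-(qw * L)) / √(N z) ^ 3 -
        3 * P z * (2 * (L * z.1 + U * z.2 - a₀) * L / 2) / √(N z) ^ 5)) +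
      ∫ z in stdTriangle, (L * (-(qw * V)) / √(N z) ^ 3 -
      3 * Q z * ((2 * (L * z.1 + U * z.2 - a₀) * U + 2 * (V * z.2 - b₀) * V) / 2) / √(N z) ^ 5) := by
    rw [← integral_add]
    · refine setIntegral_congr_fun isCompact_stdTriangle.measurableSet fun z hz => ?_
      have h1 := hs z hz
      have h2 : √(N z) ^ 2 = N z := Real.sq_sqrt (hN z hz).le
      have h3 : N z = (L * z.1 + U * z.2 - a₀) ^ 2 + (V * z.2 - b₀) ^ 2 + c ^ 2 := rfl
      have h4 : P z =
        V * (c * qu - qw * (L * z.1 + U * z.2 - a₀)) - U * (c * qv - qw * (V * z.2 - b₀)) := rfl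
      have h5 : Q z = L * (c * qv - qw * (V * z.2 - b₀)) := rfl
      rw [h4, h5]
      generalize √(N z) = r at *
      rw [h3] at h2
      field_simp
      -- The only relation needed is `R² = ρ² + c²`: it turns the `-2 q_w/R³` from the divergence of
      -- the numerator into `+q_w/R³`.
      linear_combination 3 * qw * L * V * h2
    all_goals
      refine hint (ContinuousOn.sub (ContinuousOn.div (by fun_prop) (by fun_prop) ?_)
        (ContinuousOn.div (by fun_prop) (by fun_prop) ?_))
      · exact fun z hz => (pow_pos (hs z hz) 3).ne'
      · exact fun z hz => (pow_pos (hs z hz) 5).ne'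
  refine hsum.trans ?_
  rw [hx, hy]
  -- The hypotenuse is the upper end of both families of slices, so it collects a term from `P` and
  -- one from `Q`; each leg gets only one.
  have e1 : (∫ s in (0 : ℝ)..1,
      (c * (qu * V - qv * (U - L)) - qw * ((L - a₀) * V - (-b₀) * (U - L))) /
        √(((L - a₀) + s * (U - L)) ^ 2 + ((-b₀) + s * V) ^ 2 + c ^ 2) ^ 3) =
      (∫ s in (0 : ℝ)..1, P (1 - s, s) / √(N (1 - s, s)) ^ 3) +
      ∫ s in (0 : ℝ)..1, Q (s, 1 - s) / √(N (s, 1 - s)) ^ 3 := by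
    rw [← hrev fun s => Q (s, 1 - s) / √(N (s, 1 - s)) ^ 3,
      ← intervalIntegral.integral_add (hii (by fun_prop) (by fun_prop) hhyp)]
    · congr 1
      ext s
      rw [sub_sub_cancel, ← add_div]
      simp only [hP, hQ, hNdef]
      congr 1
      · ring
      · ring_nf
    · simp only [sub_sub_cancel]
      exact hii (by fun_prop) (by fun_prop) hhyp
  have e2 : (∫ s in (0 : ℝ)..1,
        (c * (qu * (-V) - qv * (-U)) - qw * ((U - a₀) * (-V) - (V - b₀) * (-U))) /
        √(((U - a₀) + s * (-U)) ^ 2 + ((V - b₀) + s * (-V)) ^ 2 + c ^ 2) ^ 3) =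
      -∫ s in (0 : ℝ)..1, P (0, s) / √(N (0, s)) ^ 3 := by
    rw [← hrev fun s => P (0, s) / √(N (0, s)) ^ 3, ← intervalIntegral.integral_neg]
    congr 1
    ext s
    rw [← neg_div]
    simp only [hP, hNdef]
    congr 1
    · ring
    · ring_nf
  have e3 : (∫ s in (0 : ℝ)..1, (c * (qu * 0 - qv * L) - qw * ((-a₀) * 0 - (-b₀) * L)) /
        √(((-a₀) + s * L) ^ 2 + ((-b₀) + s * 0) ^ 2 + c ^ 2) ^ 3) =
      -∫ s in (0 : ℝ)..1, Q (s, 0) / √(N (s, 0)) ^ 3 := by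
    rw [← intervalIntegral.integral_neg]
    congr 1
    ext s
    rw [← neg_div]
    simp only [hQ, hNdef]
    congr 1
    · ring
    · ring_nf
  rw [e1, e2, e3]
  ring

/-! ### Surface measure on a parametrised plane -/

/-- The affine parametrisation of a plane in space by a base point and two spanning vectors. -/
noncomputable def planeMap (o e₁ e₂ : E3) (z : ℝ × ℝ) : E3 := o + (z.1 • e₁ + z.2 • e₂)

/-- The linear part of `planeMap`, on the Euclidean plane. -/
noncomputable def planeLin (e₁ e₂ : E3) : EuclideanSpace ℝ (Fin 2) →ₗ[ℝ] E3 where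
  toFun z := z 0 • e₁ + z 1 • e₂
  map_add' x y := by simp only [PiLp.add_apply]; module
  map_smul' r x := by simp only [PiLp.smul_apply, smul_eq_mul, RingHom.id_apply]; module

theorem normDet_planeLin_sq (e₁ e₂ : E3) :
    (planeLin e₁ e₂).normDet ^ 2 = ‖e₁‖ ^ 2 * ‖e₂‖ ^ 2 - ⟪e₁, e₂⟫_ℝ ^ 2 := by
  have h := (planeLin e₁ e₂).normDet_sq_eq_det_gram (EuclideanSpace.basisFun (Fin 2) ℝ)
  rw [Matrix.det_fin_two] at h
  simp only [RCLike.ofReal_real_eq_id, id] at h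
  rw [h]
  simp [Matrix.gram, planeLin, real_inner_comm e₁ e₂]
  ring

theorem continuous_planeMap (o e₁ e₂ : E3) : Continuous (planeMap o e₁ e₂) := by
  unfold planeMap; fun_prop

/-- The plane with its Lebesgue measure, as a product. -/
noncomputable def planeEquiv : EuclideanSpace ℝ (Fin 2) ≃ᵐ ℝ × ℝ :=
  (MeasurableEquiv.toLp 2 (Fin 2 → ℝ)).symm.trans MeasurableEquiv.finTwoArrow

theorem measurePreserving_planeEquiv : MeasurePreserving planeEquiv volume volume :=
  (volume_preserving_finTwoArrow ℝ).comp (PiLp.volume_preserving_ofLp (Fin 2))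

theorem planeMap_planeEquiv (o e₁ e₂ : E3) (z : EuclideanSpace ℝ (Fin 2)) :
    planeMap o e₁ e₂ (planeEquiv z) = o + planeLin e₁ e₂ z := rfl

section

variable {o e₁ e₂ : E3} {J : ℝ}

theorem injective_planeMap (hJ : 0 < J) (hJ2 : J ^ 2 = ‖e₁‖ ^ 2 * ‖e₂‖ ^ 2 - ⟪e₁, e₂⟫_ℝ ^ 2) :
    Function.Injective (planeMap o e₁ e₂) := by
  have hne : (planeLin e₁ e₂).normDet ≠ 0 := by
    intro h
    have := normDet_planeLin_sq e₁ e₂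
    rw [h, ← hJ2] at this
    nlinarith
  have hinj := ((planeLin e₁ e₂).normDet_ne_zero_tfae.out 0 4).1 hne
  intro x y hxy
  obtain ⟨x, rfl⟩ := planeEquiv.surjective x
  obtain ⟨y, rfl⟩ := planeEquiv.surjective y
  rw [planeMap_planeEquiv, planeMap_planeEquiv] at hxy
  rw [hinj (add_left_cancel hxy)]

/-- The area formula for a linear map, the Jacobian being the root of the Gram determinant;
translation is an isometry. Giving `J` by its square lets an explicit positive root be supplied
later. -/
theorem euclideanHausdorffMeasure_planeMap_image (hJ : 0 < J)
    (hJ2 : J ^ 2 = ‖e₁‖ ^ 2 * ‖e₂‖ ^ 2 - ⟪e₁, e₂⟫_ℝ ^ 2) (A : Set (ℝ × ℝ)) :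
    μHE[2] (planeMap o e₁ e₂ '' A) = ENNReal.ofReal J * volume A := by
  have hdet : (planeLin e₁ e₂).normDet = J := by
    rw [← normDet_planeLin_sq e₁ e₂] at hJ2
    exact ((sq_eq_sq₀ hJ.le (LinearMap.normDet_nonneg _)).1 hJ2).symm
  have himg : planeMap o e₁ e₂ '' A =
      IsometryEquiv.addLeft o '' (planeLin e₁ e₂ '' (planeEquiv ⁻¹' A)) := by
    ext r
    simp only [Set.mem_image, exists_exists_and_eq_and, Set.mem_preimage]
    constructor
    · rintro ⟨z, hz, rfl⟩
      obtain ⟨z, rfl⟩ := planeEquiv.surjective z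
      exact ⟨z, hz, rfl⟩
    · rintro ⟨z, hz, rfl⟩
      exact ⟨_, hz, rfl⟩
  have h := (planeLin e₁ e₂).euclideanHausdorffMeasure_image_eq_normDet_mul_volume
    (planeEquiv ⁻¹' A)
  rw [finrank_euclideanSpace_fin] at h
  rw [himg, (IsometryEquiv.addLeft o).isometry.euclideanHausdorffMeasure_image, h, hdet,
    measurePreserving_planeEquiv.measure_preimage_equiv]

theorem map_planeMap (hJ : 0 < J) (hJ2 : J ^ 2 = ‖e₁‖ ^ 2 * ‖e₂‖ ^ 2 - ⟪e₁, e₂⟫_ℝ ^ 2) :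
    (ENNReal.ofReal J • (volume : Measure (ℝ × ℝ))).map (planeMap o e₁ e₂) =
      μHE[2].restrict (Set.range (planeMap o e₁ e₂)) := by
  ext s hs
  rw [Measure.map_apply (continuous_planeMap o e₁ e₂).measurable hs, Measure.restrict_apply hs,
    ← Set.image_preimage_eq_inter_range, euclideanHausdorffMeasure_planeMap_image hJ hJ2]
  rfl

theorem map_restrict_planeMap (hJ : 0 < J)
    (hJ2 : J ^ 2 = ‖e₁‖ ^ 2 * ‖e₂‖ ^ 2 - ⟪e₁, e₂⟫_ℝ ^ 2) (S : Set (ℝ × ℝ)) :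
    (ENNReal.ofReal J • (volume.restrict S : Measure (ℝ × ℝ))).map (planeMap o e₁ e₂) =
      μHE[2].restrict (planeMap o e₁ e₂ '' S) := by
  have hemb := (continuous_planeMap o e₁ e₂).measurableEmbedding (injective_planeMap hJ hJ2)
  rw [← Measure.restrict_smul]
  have h := hemb.restrict_map (ENNReal.ofReal J • (volume : Measure (ℝ × ℝ)))
    (planeMap o e₁ e₂ '' S)
  rw [Set.preimage_image_eq _ (injective_planeMap hJ hJ2)] at h
  rw [← h, map_planeMap hJ hJ2, Measure.restrict_restrict_of_subset (Set.image_subset_range _ _)]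

theorem setIntegral_planeMap_image (hJ : 0 < J)
    (hJ2 : J ^ 2 = ‖e₁‖ ^ 2 * ‖e₂‖ ^ 2 - ⟪e₁, e₂⟫_ℝ ^ 2) (S : Set (ℝ × ℝ)) (f : E3 → ℝ) :
    ∫ r in planeMap o e₁ e₂ '' S, f r ∂μHE[2] = ∫ z in S, J * f (planeMap o e₁ e₂ z) := by
  have hemb := (continuous_planeMap o e₁ e₂).measurableEmbedding (injective_planeMap hJ hJ2)
  rw [← map_restrict_planeMap hJ hJ2, hemb.integral_map, integral_smul_measure,
    ENNReal.toReal_ofReal hJ.le, integral_const_mul, smul_eq_mul]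

theorem integrableOn_planeMap_image (hJ : 0 < J)
    (hJ2 : J ^ 2 = ‖e₁‖ ^ 2 * ‖e₂‖ ^ 2 - ⟪e₁, e₂⟫_ℝ ^ 2) {S : Set (ℝ × ℝ)} {f : E3 → ℝ}
    (hf : IntegrableOn (fun z => f (planeMap o e₁ e₂ z)) S) :
    IntegrableOn f (planeMap o e₁ e₂ '' S) μHE[2] := by
  have hemb := (continuous_planeMap o e₁ e₂).measurableEmbedding (injective_planeMap hJ hJ2)
  rw [IntegrableOn, ← map_restrict_planeMap hJ hJ2, hemb.integrable_map_iff]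
  exact Integrable.smul_measure hf ENNReal.ofReal_ne_top

end

theorem planeMap_image_stdTriangle (p : Fin 3 → E3) :
    planeMap (p 0) (p 1 - p 0) (p 2 - p 0) '' stdTriangle = Tri.tri p := by
  apply Set.Subset.antisymm
  · rintro _ ⟨⟨x, y⟩, ⟨hx, hy, hxy⟩, rfl⟩
    replace hxy : x + y ≤ 1 := hxy
    replace hx : 0 ≤ x := hx
    replace hy : 0 ≤ y := hy
    -- Barycentric coordinates of the point with parameters `(x, y)`.
    have hw : ∀ i ∈ Finset.univ, 0 ≤ (![1 - x - y, x, y] : Fin 3 → ℝ) i := by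
      intro i _
      fin_cases i <;> simp <;> linarith
    have hw1 : ∑ i, (![1 - x - y, x, y] : Fin 3 → ℝ) i = 1 := by
      simp only [Fin.sum_univ_three, Matrix.cons_val]; ring
    have h := (convex_convexHull ℝ (Set.range p)).sum_mem (z := p) hw hw1
      fun i _ => subset_convexHull ℝ _ ⟨i, rfl⟩
    simp only [Fin.sum_univ_three, Matrix.cons_val] at h
    have he : planeMap (p 0) (p 1 - p 0) (p 2 - p 0) (x, y) =
        (1 - x - y) • p 0 + x • p 1 + y • p 2 := by
      simp only [planeMap]
      module
    rw [he]
    exact h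
  · refine convexHull_min ?_ ?_
    · rintro _ ⟨i, rfl⟩
      fin_cases i
      · exact ⟨(0, 0), by simp [stdTriangle], by simp [planeMap]⟩
      · exact ⟨(1, 0), by simp [stdTriangle], by simp [planeMap]⟩
      · exact ⟨(0, 1), by simp [stdTriangle], by simp [planeMap]⟩
    · rintro _ ⟨x, ⟨hx1, hx2, hx3⟩, rfl⟩ _ ⟨y, ⟨hy1, hy2, hy3⟩, rfl⟩ a b ha hb hab
      refine ⟨a • x + b • y, ⟨?_, ?_, ?_⟩, ?_⟩
      · simp only [Prod.fst_add, Prod.smul_fst, smul_eq_mul]; positivity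
      · simp only [Prod.snd_add, Prod.smul_snd, smul_eq_mul]; positivity
      · simp only [Prod.fst_add, Prod.smul_fst, Prod.snd_add, Prod.smul_snd, smul_eq_mul]
        nlinarith
      · obtain rfl : b = 1 - a := by linarith
        simp only [planeMap, Prod.fst_add, Prod.smul_fst, Prod.snd_add, Prod.smul_snd, smul_eq_mul]
        module

/-! ### Cross product identities and orthonormal frames -/

theorem inner_E3 (a b : E3) : ⟪a, b⟫_ℝ = a 0 * b 0 + a 1 * b 1 + a 2 * b 2 := by
  simp [PiLp.inner_apply, Fin.sum_univ_three, mul_comm]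

theorem cross3_apply_zero (a b : E3) : cross3 a b 0 = a 1 * b 2 - a 2 * b 1 := by
  simp [cross3, cross_apply]

theorem cross3_apply_one (a b : E3) : cross3 a b 1 = a 2 * b 0 - a 0 * b 2 := by
  simp [cross3, cross_apply]

theorem cross3_apply_two (a b : E3) : cross3 a b 2 = a 0 * b 1 - a 1 * b 0 := by
  simp [cross3, cross_apply]

theorem cross3_smul_left (t : ℝ) (a b : E3) : cross3 (t • a) b = t • cross3 a b := by
  simp [cross3]

theorem cross3_smul_right (t : ℝ) (a b : E3) : cross3 a (t • b) = t • cross3 a b := by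
  simp [cross3]

theorem cross3_add_left (a b c : E3) : cross3 (a + b) c = cross3 a c + cross3 b c := by
  simp [cross3]

theorem cross3_anticomm (a b : E3) : cross3 a b = -cross3 b a := by
  rw [cross3, ← cross_anticomm, WithLp.toLp_neg]; rfl

theorem inner_self_cross3 (a b : E3) : ⟪a, cross3 a b⟫_ℝ = 0 := by
  rw [inner_E3, cross3_apply_zero, cross3_apply_one, cross3_apply_two]; ring

theorem inner_cross3_self (a b : E3) : ⟪b, cross3 a b⟫_ℝ = 0 := by
  rw [inner_E3, cross3_apply_zero, cross3_apply_one, cross3_apply_two]; ring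

theorem inner_cross3_rotate (a b c : E3) : ⟪a, cross3 b c⟫_ℝ = ⟪b, cross3 c a⟫_ℝ := by
  simp only [inner_E3, cross3_apply_zero, cross3_apply_one, cross3_apply_two]; ring

theorem inner_cross3_cross3 (a b c d : E3) :
    ⟪cross3 a b, cross3 c d⟫_ℝ = ⟪a, c⟫_ℝ * ⟪b, d⟫_ℝ - ⟪a, d⟫_ℝ * ⟪b, c⟫_ℝ := by
  simp only [inner_E3, cross3_apply_zero, cross3_apply_one, cross3_apply_two]; ring

theorem cross3_cross3 (a b c : E3) :
    cross3 (cross3 a b) c = ⟪a, c⟫_ℝ • b - ⟪b, c⟫_ℝ • a := by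
  ext i
  fin_cases i <;>
  simp [inner_E3, cross3_apply_zero, cross3_apply_one, cross3_apply_two] <;> ring

/-- Expansion in the orthonormal frame `u, w × u, w`. -/
theorem frame_expansion {u w : E3} (hu : ⟪u, u⟫_ℝ = 1) (hw : ⟪w, w⟫_ℝ = 1) (huw : ⟪u, w⟫_ℝ = 0)
    (x : E3) :
    x = ⟪x, u⟫_ℝ • u + ⟪x, cross3 w u⟫_ℝ • cross3 w u + ⟪x, w⟫_ℝ • w := by
  have hwu : ⟪w, u⟫_ℝ = 0 := by rw [real_inner_comm, huw]
  have hvv : ⟪cross3 w u, cross3 w u⟫_ℝ = 1 := by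
    rw [inner_cross3_cross3, hu, hw, huw]; ring
  have huv : ⟪u, cross3 w u⟫_ℝ = 0 := inner_cross3_self w u
  have hwv : ⟪w, cross3 w u⟫_ℝ = 0 := inner_self_cross3 w u
  have hon : Orthonormal ℝ ![u, cross3 w u, w] := by
    rw [orthonormal_iff_ite]
    intro i j
    fin_cases i <;> fin_cases j <;>
      simp [-inner_self_eq_norm_sq_to_K, hu, hw, huw, hwu, hvv, huv, hwv, real_inner_comm u (cross3 w u),
        real_inner_comm w (cross3 w u)]
  let b := OrthonormalBasis.mk hon (by
    rw [hon.linearIndependent.span_eq_top_of_card_eq_finrank (by simp)])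
  have h := b.sum_repr' x
  simp only [Fin.sum_univ_three, b, OrthonormalBasis.coe_mk, Matrix.cons_val] at h
  rw [real_inner_comm x u, real_inner_comm x w, real_inner_comm x (cross3 w u)] at h
  exact h.symm

/-! ### The local frame of the triangle -/

namespace Tri

variable {p : Fin 3 → E3}

theorem side_zero (p : Fin 3 → E3) : side p 0 = p 2 - p 1 := rfl

theorem side_one (p : Fin 3 → E3) : side p 1 = p 0 - p 2 := rfl

theorem side_two (p : Fin 3 → E3) : side p 2 = p 1 - p 0 := rfl

theorem len_pos (hp : AffineIndependent ℝ p) (i : Fin 3) : 0 < len p i := by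
  refine norm_pos_iff.2 (sub_ne_zero.2 fun h => ?_)
  have := hp.injective h
  revert this
  fin_cases i <;> decide

theorem len_smul_sHat (hp : AffineIndependent ℝ p) (i : Fin 3) : len p i • sHat p i = side p i := by
  rw [sHat, smul_smul, mul_inv_cancel₀ (len_pos hp i).ne', one_smul]

/-- Guarantees that the normalisation defining `wHat` is not a division by zero. -/
theorem cross3_sHat_ne_zero (hp : AffineIndependent ℝ p) : cross3 (sHat p 0) (sHat p 1) ≠ 0 := by
  have hli : LinearIndependent ℝ ![side p 0, side p 1] := by
    rw [LinearIndependent.pair_iff]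
    intro s t hst
    rw [side_zero, side_one] at hst
    -- These are the coefficients of `p 0, p 1, p 2` in `s (p 2 - p 1) + t (p 0 - p 2)`; they sum to
    -- zero.
    have h := (affineIndependent_iff.1 hp) Finset.univ ![t, -s, s - t]
      (by simp only [Fin.sum_univ_three, Matrix.cons_val]; ring) (by
        simp only [Fin.sum_univ_three, Matrix.cons_val]
        rw [← hst]; module)
    have h0 := h 0 (Finset.mem_univ _)
    have h1 := h 1 (Finset.mem_univ _)
    simp at h0 h1
    exact ⟨h1, h0⟩
  have hne : cross3 (side p 0) (side p 1) ≠ 0 := by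
    intro h
    have h' : crossProduct (side p 0).ofLp (side p 1).ofLp = 0 := by
      simpa [cross3] using h
    refine (crossProduct_ne_zero_iff_linearIndependent.2 ?_) h'
    have := hli.map' (WithLp.linearEquiv 2 ℝ (Fin 3 → ℝ)).toLinearMap (LinearEquiv.ker _)
    rwa [show (WithLp.linearEquiv 2 ℝ (Fin 3 → ℝ)).toLinearMap ∘ ![side p 0, side p 1] =
      ![(side p 0).ofLp, (side p 1).ofLp] by ext i; fin_cases i <;> rfl] at this
  rw [← len_smul_sHat hp 0, ← len_smul_sHat hp 1, cross3_smul_left, cross3_smul_right] at hne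
  intro h
  rw [h] at hne
  simp at hne

theorem inner_wHat_self (hp : AffineIndependent ℝ p) : ⟪wHat p, wHat p⟫_ℝ = 1 := by
  rw [real_inner_self_eq_norm_sq, wHat, norm_smul, norm_inv, norm_norm,
    inv_mul_cancel₀ (norm_ne_zero_iff.2 (cross3_sHat_ne_zero hp)), one_pow]

theorem inner_uHat_self (hp : AffineIndependent ℝ p) : ⟪uHat p, uHat p⟫_ℝ = 1 := by
  have h : ‖side p 2‖ ≠ 0 := (len_pos hp 2).ne'
  rw [real_inner_self_eq_norm_sq, uHat, sHat, norm_smul, norm_inv, len, norm_norm,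
    inv_mul_cancel₀ h, one_pow]

theorem side_two_eq (hp : AffineIndependent ℝ p) : side p 2 = len p 2 • uHat p :=
  (len_smul_sHat hp 2).symm

theorem inner_side_zero_wHat (hp : AffineIndependent ℝ p) : ⟪side p 0, wHat p⟫_ℝ = 0 := by
  rw [← len_smul_sHat hp, wHat, inner_smul_left, inner_smul_right, inner_self_cross3]; simp

theorem inner_side_one_wHat (hp : AffineIndependent ℝ p) : ⟪side p 1, wHat p⟫_ℝ = 0 := by
  rw [← len_smul_sHat hp, wHat, inner_smul_left, inner_smul_right, inner_cross3_self]; simp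

theorem inner_uHat_wHat (hp : AffineIndependent ℝ p) : ⟪uHat p, wHat p⟫_ℝ = 0 := by
  have h : side p 2 = -side p 0 - side p 1 := by
    rw [side_zero, side_one, side_two]; abel
  rw [uHat, sHat, inner_smul_left, h, inner_sub_left, inner_neg_left, inner_side_zero_wHat hp,
    inner_side_one_wHat hp]
  simp

theorem frame_eq (hp : AffineIndependent ℝ p) (x : E3) :
    x = ⟪x, uHat p⟫_ℝ • uHat p + ⟪x, vHat p⟫_ℝ • vHat p + ⟪x, wHat p⟫_ℝ • wHat p :=
  frame_expansion (inner_uHat_self hp) (inner_wHat_self hp) (inner_uHat_wHat hp) x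

theorem inner_vHat_self (hp : AffineIndependent ℝ p) : ⟪vHat p, vHat p⟫_ℝ = 1 := by
  rw [vHat, inner_cross3_cross3, inner_uHat_self hp, inner_wHat_self hp, inner_uHat_wHat hp]; ring

theorem inner_uHat_vHat (p : Fin 3 → E3) : ⟪uHat p, vHat p⟫_ℝ = 0 := inner_cross3_self _ _

theorem inner_wHat_vHat (p : Fin 3 → E3) : ⟪wHat p, vHat p⟫_ℝ = 0 := inner_self_cross3 _ _

theorem side_one_eq (hp : AffineIndependent ℝ p) :
    side p 1 = (-u3 p) • uHat p + (-v3 p) • vHat p := by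
  have h := frame_eq hp (side p 1)
  rw [inner_side_one_wHat hp, zero_smul, add_zero] at h
  rwa [u3, v3, neg_neg, neg_neg]

theorem side_zero_eq (hp : AffineIndependent ℝ p) :
    side p 0 = (u3 p - len p 2) • uHat p + v3 p • vHat p := by
  have h : side p 0 = -side p 1 - side p 2 := by
    rw [side_zero, side_one, side_two]; abel
  rw [h, side_one_eq hp, side_two_eq hp]
  module

theorem inner_frame (hp : AffineIndependent ℝ p) (a b c d e f : ℝ) :
    ⟪a • uHat p + b • vHat p + c • wHat p, d • uHat p + e • vHat p + f • wHat p⟫_ℝ =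
      a * d + b * e + c * f := by
  simp only [inner_add_left, inner_add_right, inner_smul_left, inner_smul_right,
    inner_uHat_self hp, inner_vHat_self hp, inner_wHat_self hp, inner_uHat_wHat hp,
    inner_uHat_vHat p, inner_wHat_vHat p, real_inner_comm (uHat p) (wHat p),
    real_inner_comm (uHat p) (vHat p), real_inner_comm (wHat p) (vHat p)]
  simp
  ring

theorem norm_sq_plane (hp : AffineIndependent ℝ p) (a b : ℝ) :
    ‖a • uHat p + b • vHat p‖ ^ 2 = a ^ 2 + b ^ 2 := by
  have h := inner_frame hp a b 0 a b 0
  rw [zero_smul, add_zero, real_inner_self_eq_norm_sq] at h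
  rw [h]; ring

theorem len_zero_sq (hp : AffineIndependent ℝ p) :
    len p 0 ^ 2 = (u3 p - len p 2) ^ 2 + v3 p ^ 2 := by
  conv_lhs => rw [len, side_zero_eq hp, norm_sq_plane hp]

theorem len_one_sq (hp : AffineIndependent ℝ p) : len p 1 ^ 2 = (-u3 p) ^ 2 + (-v3 p) ^ 2 := by
  conv_lhs => rw [len, side_one_eq hp, norm_sq_plane hp]

/-- Choosing `ŵ` along `ŝ₁ × ŝ₂` orients the triangle counterclockwise in `û, v̂`: `len p 2 * v3 p`
is the `ŵ`-component of a positive multiple of `ŵ`. This makes the Jacobian positive and the `m̂ᵢ`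
outward. -/
theorem v3_pos (hp : AffineIndependent ℝ p) : 0 < v3 p := by
  have hn := norm_pos_iff.2 (cross3_sHat_ne_zero hp)
  have h1 : cross3 (side p 0) (side p 1) =
      (len p 0 * len p 1 * ‖cross3 (sHat p 0) (sHat p 1)‖) • wHat p := by
    rw [← len_smul_sHat hp 0, ← len_smul_sHat hp 1, cross3_smul_left, cross3_smul_right, wHat,
      smul_smul, smul_smul, mul_assoc _ _ (_⁻¹), mul_inv_cancel₀ hn.ne', mul_one]
  have h2 : ⟪wHat p, cross3 (side p 0) (side p 1)⟫_ℝ = len p 2 * v3 p := by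
    -- The sides sum to zero, so consecutive pairs have the same cross product.
    have h3 : cross3 (side p 0) (side p 1) = cross3 (side p 1) (side p 2) := by
      rw [side_zero, side_one, side_two]
      ext i
      fin_cases i <;> simp [cross3_apply_zero, cross3_apply_one, cross3_apply_two] <;> ring
    rw [h3, inner_cross3_rotate, side_two_eq hp, cross3_smul_left, cross3_anticomm (uHat p),
      inner_smul_right, inner_neg_right]
    rfl
  rw [h1, inner_smul_right, inner_wHat_self hp, mul_one] at h2
  have := mul_pos (mul_pos (len_pos hp 0) (len_pos hp 1)) hn
  rw [h2] at this
  exact pos_of_mul_pos_right this (len_pos hp 2).le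

/-- The in-plane rotation `x ↦ x × ŵ` in the frame `û, v̂`. -/
theorem cross3_wHat (hp : AffineIndependent ℝ p) (a b : ℝ) :
    cross3 (a • uHat p + b • vHat p) (wHat p) = b • uHat p + (-a) • vHat p := by
  rw [cross3_add_left, cross3_smul_left, cross3_smul_left, cross3_anticomm (uHat p), ← vHat,
    vHat, cross3_cross3, inner_wHat_self hp, inner_uHat_wHat hp]
  module

end Tri

/-! ### Normal derivative of the kernel -/

/-- Since the kernel is differentiable away from the source, its gradient can be tested along the
line `r + t w`, where `|R|` is the root of a quadratic in `t` and one-variable calculus suffices. -/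
theorem inner_gradient_dipoleKernel (q w : E3) {r₀ r : E3} (hr : r ≠ r₀) :
    ⟪w, gradient (dipoleKernel q r₀) r⟫_ℝ =
      ⟪q, w⟫_ℝ / ‖r - r₀‖ ^ 3 - 3 * ⟪q, r - r₀⟫_ℝ * ⟪r - r₀, w⟫_ℝ / ‖r - r₀‖ ^ 5 := by
  have hne : r - r₀ ≠ 0 := sub_ne_zero.2 hr
  have hd : DifferentiableAt ℝ (dipoleKernel q r₀) r := by
    have hR : DifferentiableAt ℝ (fun r : E3 => r - r₀) r := by fun_prop
    have hI : DifferentiableAt ℝ (fun r : E3 => ⟪q, r - r₀⟫_ℝ) r :=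
      (differentiableAt_const q).inner ℝ hR
    have hn3 : DifferentiableAt ℝ (fun r : E3 => ‖r - r₀‖ ^ 3) r := (hR.norm ℝ hne).pow 3
    exact hI.mul (hn3.inv (pow_ne_zero 3 (norm_ne_zero_iff.2 hne)))
  have hn : ∀ t : ℝ, ‖r + t • w - r₀‖ =
      √(‖r - r₀‖ ^ 2 + 2 * t * ⟪r - r₀, w⟫_ℝ + t ^ 2 * ‖w‖ ^ 2) := by
    intro t
    rw [← Real.sqrt_sq (norm_nonneg (r + t • w - r₀)),
      show r + t • w - r₀ = r - r₀ + t • w by abel, norm_add_sq_real, inner_smul_right, norm_smul,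
      mul_pow, Real.norm_eq_abs, sq_abs, mul_assoc 2 t]
  have hline : HasLineDerivAt ℝ (dipoleKernel q r₀)
      (⟪q, w⟫_ℝ / ‖r - r₀‖ ^ 3 - 3 * ⟪q, r - r₀⟫_ℝ * ⟪r - r₀, w⟫_ℝ / ‖r - r₀‖ ^ 5) r w := by
    have h1 : HasDerivAt (fun t : ℝ => ⟪q, r - r₀⟫_ℝ + t * ⟪q, w⟫_ℝ) ⟪q, w⟫_ℝ 0 := by
      simpa using ((hasDerivAt_id (0 : ℝ)).mul_const ⟪q, w⟫_ℝ).const_add ⟪q, r - r₀⟫_ℝ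
    have h2 : HasDerivAt
        (fun t : ℝ => ‖r - r₀‖ ^ 2 + 2 * t * ⟪r - r₀, w⟫_ℝ + t ^ 2 * ‖w‖ ^ 2)
        (2 * ⟪r - r₀, w⟫_ℝ) 0 := by
      simpa using ((((hasDerivAt_id (0 : ℝ)).const_mul 2).mul_const ⟪r - r₀, w⟫_ℝ).const_add
        (‖r - r₀‖ ^ 2)).fun_add ((hasDerivAt_pow 2 (0 : ℝ)).mul_const (‖w‖ ^ 2))
    have h3 := h1.div_sqrt_pow_three h2 (by
      simpa using pow_pos (norm_pos_iff.2 hne) 2)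
    simp only [← hn, zero_smul, add_zero, zero_mul] at h3
    rw [mul_div_cancel_left₀ _ two_ne_zero] at h3
    rw [HasLineDerivAt]
    refine h3.congr_of_eventuallyEq (Filter.Eventually.of_forall fun t => ?_)
    have : r + t • w - r₀ = r - r₀ + t • w := by abel
    simp only [dipoleKernel]
    congr 1
    rw [this, inner_add_right, inner_smul_right]
  rw [real_inner_comm, gradient, InnerProductSpace.toDual_symm_apply,
    ← hd.lineDeriv_eq_fderiv, hline.lineDeriv]

/-! ### Local coordinates of the parametrised triangle, and assembly -/

namespace Tri

variable {p : Fin 3 → E3}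

/-- The minus sign before `w₀ ŵ` in the source position is what makes the height of `R` equal to
`+w₀`. -/
theorem planeMap_sub_eq (hp : AffineIndependent ℝ p) (r₀ : E3) (z : ℝ × ℝ) :
    planeMap (p 0) (p 1 - p 0) (p 2 - p 0) z - r₀ =
      (len p 2 * z.1 + u3 p * z.2 - u0 p r₀) • uHat p + (v3 p * z.2 - v0 p r₀) • vHat p +
        w0 p r₀ • wHat p := by
  have h1 : p 1 - p 0 = len p 2 • uHat p := side_two_eq hp
  have h2 : p 2 - p 0 = u3 p • uHat p + v3 p • vHat p := by
    rw [← neg_sub, ← side_one, side_one_eq hp]; module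
  have h3 : p 0 = r₀ - (u0 p r₀ • uHat p + v0 p r₀ • vHat p + (-w0 p r₀) • wHat p) := by
    rw [u0, v0, w0, neg_neg, ← frame_eq hp]; abel
  have h4 : planeMap (p 0) (p 1 - p 0) (p 2 - p 0) z - r₀ =
      (p 0 - r₀) + (z.1 • (p 1 - p 0) + z.2 • (p 2 - p 0)) := by
    rw [planeMap]; abel
  have h5 : p 0 - r₀ = -(u0 p r₀ • uHat p + v0 p r₀ • vHat p + (-w0 p r₀) • wHat p) := by
    nth_rewrite 1 [h3]; abel
  rw [h4, h5, h1, h2]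
  module

theorem area_sq (hp : AffineIndependent ℝ p) :
    (len p 2 * v3 p) ^ 2 =
      ‖p 1 - p 0‖ ^ 2 * ‖p 2 - p 0‖ ^ 2 - ⟪p 1 - p 0, p 2 - p 0⟫_ℝ ^ 2 := by
  have h1 : p 1 - p 0 = len p 2 • uHat p + (0 : ℝ) • vHat p + (0 : ℝ) • wHat p := by
    rw [← side_two, side_two_eq hp]; module
  have h2 : p 2 - p 0 = u3 p • uHat p + v3 p • vHat p + (0 : ℝ) • wHat p := by
    rw [← neg_sub, ← side_one, side_one_eq hp]; module
  rw [← real_inner_self_eq_norm_sq, ← real_inner_self_eq_norm_sq, h1, h2, inner_frame hp,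
    inner_frame hp, inner_frame hp]
  ring

/-- Identifies the coefficient of `c` in `integral_side` as `q·m̂ᵢ`. -/
theorem inner_mHat (hp : AffineIndependent ℝ p) (q : E3) (i : Fin 3) {a b : ℝ}
    (h : side p i = a • uHat p + b • vHat p) :
    ⟪q, mHat p i⟫_ℝ = (⟪q, uHat p⟫_ℝ * b - ⟪q, vHat p⟫_ℝ * a) / len p i := by
  rw [mHat, sHat, cross3_smul_left, h, cross3_wHat hp, inner_smul_right, inner_add_right,
    inner_smul_right, inner_smul_right, div_eq_inv_mul]
  ring

end Tri

theorem mainTheorem1 (p : Fin 3 → E3) (hp : AffineIndependent ℝ p) (q r₀ : E3)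
    (hr₀ : r₀ ∉ Tri.tri p) :
    IntegrableOn (fun r : E3 => ⟪Tri.wHat p, gradient (dipoleKernel q r₀) r⟫_ℝ)
        (Tri.tri p) μHE[2] ∧
      ∫ r in Tri.tri p, ⟪Tri.wHat p, gradient (dipoleKernel q r₀) r⟫_ℝ ∂μHE[2] =
        ⟪q, ∑ i : Fin 3, Tri.Rs p r₀ i •
          (Tri.w0 p r₀ • Tri.mHat p i - Tri.t0 p r₀ i • Tri.wHat p)⟫_ℝ := by
  have hL := Tri.len_pos hp 2
  have hV := Tri.v3_pos hp
  have hJ : 0 < Tri.len p 2 * Tri.v3 p := mul_pos hL hV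
  have hJ2 := Tri.area_sq hp
  set Φ := planeMap (p 0) (p 1 - p 0) (p 2 - p 0) with hΦ
  set qu := ⟪q, Tri.uHat p⟫_ℝ with hqu
  set qv := ⟪q, Tri.vHat p⟫_ℝ with hqv
  set qw := ⟪q, Tri.wHat p⟫_ℝ with hqw
  have himg : Φ '' stdTriangle = Tri.tri p := planeMap_image_stdTriangle p
  have hsub := fun z => Tri.planeMap_sub_eq hp r₀ z
  rw [← hΦ] at hsub
  set N : ℝ × ℝ → ℝ := fun z => (Tri.len p 2 * z.1 + Tri.u3 p * z.2 - Tri.u0 p r₀) ^ 2 +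
    (Tri.v3 p * z.2 - Tri.v0 p r₀) ^ 2 + Tri.w0 p r₀ ^ 2 with hN
  have hne : ∀ z ∈ stdTriangle, Φ z ≠ r₀ := fun z hz h =>
    hr₀ (by rw [← h, ← himg]; exact ⟨z, hz, rfl⟩)
  have hnsq : ∀ z, ‖Φ z - r₀‖ ^ 2 = N z := fun z => by
    rw [← real_inner_self_eq_norm_sq, hsub, Tri.inner_frame hp]; simp only [hN]; ring
  have hnorm : ∀ z, ‖Φ z - r₀‖ = √(N z) := fun z => by
    rw [← hnsq, Real.sqrt_sq (norm_nonneg _)]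
  have hpos : ∀ z ∈ stdTriangle, 0 < N z := fun z hz => by
    rw [← hnsq]; exact pow_pos (norm_pos_iff.2 (sub_ne_zero.2 (hne z hz))) 2
  have hq : q = qu • Tri.uHat p + qv • Tri.vHat p + qw • Tri.wHat p := Tri.frame_eq hp q
  have hqR : ∀ z, ⟪q, Φ z - r₀⟫_ℝ =
      qu * (Tri.len p 2 * z.1 + Tri.u3 p * z.2 - Tri.u0 p r₀) +
        qv * (Tri.v3 p * z.2 - Tri.v0 p r₀) + qw * Tri.w0 p r₀ := fun z => by
    conv_lhs => rw [hq, hsub, Tri.inner_frame hp]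
  have hRw : ∀ z, ⟪Φ z - r₀, Tri.wHat p⟫_ℝ = Tri.w0 p r₀ := fun z => by
    have h := Tri.inner_frame hp (Tri.len p 2 * z.1 + Tri.u3 p * z.2 - Tri.u0 p r₀)
      (Tri.v3 p * z.2 - Tri.v0 p r₀) (Tri.w0 p r₀) 0 0 1
    rw [← hsub, zero_smul, zero_smul, one_smul, zero_add, zero_add] at h
    rw [h]; ring
  have hgrad : ∀ z ∈ stdTriangle, ⟪Tri.wHat p, gradient (dipoleKernel q r₀) (Φ z)⟫_ℝ =
      qw / √(N z) ^ 3 - 3 * Tri.w0 p r₀ *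
        (qu * (Tri.len p 2 * z.1 + Tri.u3 p * z.2 - Tri.u0 p r₀) +
        qv * (Tri.v3 p * z.2 - Tri.v0 p r₀) + qw * Tri.w0 p r₀) / √(N z) ^ 5 := fun z hz => by
    rw [inner_gradient_dipoleKernel q _ (hne z hz), hqR, hRw, hnorm]; ring
  have hmeas := isCompact_stdTriangle.measurableSet
  constructor
  · rw [← himg]
    refine integrableOn_planeMap_image hJ hJ2 ?_
    refine IntegrableOn.congr_fun ?_ (fun z hz => (hgrad z hz).symm) hmeas
    refine ContinuousOn.integrableOn_compact isCompact_stdTriangle ?_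
    -- No singularity: the distance to the source is positive throughout the compact triangle.
    refine ContinuousOn.sub (ContinuousOn.div (by fun_prop) (by fun_prop) ?_)
      (ContinuousOn.div (by fun_prop) (by fun_prop) ?_)
    · exact fun z hz => (pow_pos (Real.sqrt_pos.2 (hpos z hz)) 3).ne'
    · exact fun z hz => (pow_pos (Real.sqrt_pos.2 (hpos z hz)) 5).ne'
  · have h0 := Tri.len_pos hp 0
    have h1 := Tri.len_pos hp 1
    rw [← himg, setIntegral_planeMap_image hJ hJ2,
      setIntegral_congr_fun hmeas fun z hz => congrArg (_ * ·) (hgrad z hz)]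
    refine (integral_stdTriangle_dipole hpos).trans ?_
    -- The three segments are sides `0, 1, 2` in turn, each run from `pᵢ₊₁` to `pᵢ₋₁`. The side
    -- conditions say that `tᵢ⁰, sᵢ⁻, sᵢ⁺` are the aligned coordinates of its end points relative to
    -- the source.
    rw [integral_side (t := Tri.t0 p r₀ 0) (sm := Tri.sMinus p r₀ 0) (sp := Tri.sPlus p r₀ 0) h0
        (Tri.len_zero_sq hp)
        (by simp only [Tri.t0, Matrix.cons_val]; field_simp; ring)
        (by simp only [Tri.sMinus, Matrix.cons_val]; field_simp; ring)
        (by simp only [Tri.sPlus, Matrix.cons_val]; field_simp; ring),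
      integral_side (t := Tri.t0 p r₀ 1) (sm := Tri.sMinus p r₀ 1) (sp := Tri.sPlus p r₀ 1) h1
        (Tri.len_one_sq hp)
        (by simp only [Tri.t0, Matrix.cons_val]; field_simp; ring)
        (by simp only [Tri.sMinus, Matrix.cons_val]; field_simp; ring)
        (by simp only [Tri.sPlus, Matrix.cons_val]; field_simp; ring),
      integral_side (t := Tri.t0 p r₀ 2) (sm := Tri.sMinus p r₀ 2) (sp := Tri.sPlus p r₀ 2) hL
        (by ring)
        (by simp only [Tri.t0, Matrix.cons_val]; ring)
        (by simp only [Tri.sMinus, Matrix.cons_val]; ring)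
        (by simp only [Tri.sPlus, Matrix.cons_val]; ring)]
    simp only [Fin.sum_univ_three, inner_add_right, inner_smul_right, inner_sub_right]
    rw [Tri.inner_mHat hp q 0 (Tri.side_zero_eq hp), Tri.inner_mHat hp q 1 (Tri.side_one_eq hp),
      Tri.inner_mHat hp q 2 (a := Tri.len p 2) (b := 0) (by rw [Tri.side_two_eq hp]; module)]
    simp only [Tri.Rs, Tri.R0, Tri.RPlus, Tri.RMinus, ← hqu, ← hqv, ← hqw]
    ring
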